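/- Let $p_1\neq p_2$ be primes. For an abelian group $G$ and a prime $p$ put $p^\omega G=\bigcap_{n\ge 0}p^nG$. For an infinite cardinal $\kappa$ let $\mathbf K_2(\kappa)=(K_2(\kappa),\le_{\mathbf K_2})$, where $K_2(\kappa)$ is the class of torsion-free abelian groups $G$ with $|p_1^\omega G|\le\kappa$ and $|p_2^\omega G|\le\kappa$, and where, for $G,H\in K_2(\kappa)$, $G\le_{\mathbf K_2}H$ means that $G$ is a pure subgroup of $H$ (that is, $nG=G\cap nH$ for all $n\in\mathbb Z$), that $p_1^\omega G=p_1^\omega H$, and that $p_2^\omega G=p_1^\omega G$ or $p_2^\omega G=p_2^\omega H$. Write $\mathbf K=(K,\le_{\mathbf K})$ for such a class. A $\mathbf K$-embedding is an injective homomorphism $f:M\to N$ between members of $K$ with $f[M]\le_{\mathbf K}N$. For $N_1,N_2\in K$, a set $A\subseteq N_1\cap N_2$ of common elements, $b_1\in N_1$ and $b_2\in N_2$, the triples $(b_1,A,N_1)$ and $(b_2,A,N_2)$ are related by $E_{at}$ if there are $N\in K$ and $\mathbf K$-embeddings $f_i:N_i\to N$ that agree on $A$ and satisfy $f_1(b_1)=f_2(b_2)$.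 Let $E$ be the transitive closure of $E_{at}$. The Galois type $\mathbf{gtp}(b/A;N)$ is the $E$-class of $(b,A,N)$; for $M\in K$, $\mathbf{gS}(M)$ is the set of all $\mathbf{gtp}(b/M;N)$ with $M\le_{\mathbf K}N$ and $b\in N$; and for $B\subseteq M$, $\mathbf{gtp}(b/M;N)\upharpoonright B=\mathbf{gtp}(b/B;N)$. For infinite cardinals $\lambda,\theta$, $\mathbf K$ is $(<\lambda,\theta)$-tame if for every $M\in K$ with $|M|=\theta$ and all $p\ne q$ in $\mathbf{gS}(M)$ there is $B\subseteq M$ with $|B|<\lambda$ and $p\upharpoonright B\neq q\upharpoonright B$. Let $\mu$ be a regular uncountable cardinal that is smaller than every measurable cardinal (a measurable cardinal being an uncountable cardinal $\kappa$ such that there is a nonprincipal $\kappa$-complete ultrafilter on $\kappa$). Then for every cardinal $\theta\ge 2^\mu$, $\mathbf K_2(2^\mu)$ is not $(<\mu,\theta)$-tame. -/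

import Mathlib

open Cardinal

universe u

/-! ### Abelian groups -/

/-- `p^ω G`, the subgroup of those `g ∈ G` that are divisible by `p ^ n` in `G` for every `n`. -/
def pOmega (p : ℕ) (G : Type u) [AddCommGroup G] : AddSubgroup G :=
  ⨅ n : ℕ, (nsmulAddMonoidHom (p ^ n) : G →+ G).range

theorem mem_pOmega {p : ℕ} {G : Type u} [AddCommGroup G] {g : G} :
    g ∈ pOmega p G ↔ ∀ n : ℕ, ∃ h : G, p ^ n • h = g := by
  simp [pOmega, AddSubgroup.mem_iInf]

/-- For a subgroup `G` of `H`, the group `p^ω G` (divisibility is computed inside `G`),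
regarded as a subgroup of `H`. -/
def pOmegaSub (p : ℕ) {H : Type u} [AddCommGroup H] (G : AddSubgroup H) : AddSubgroup H :=
  (pOmega p G).map G.subtype

/-- `G` is a pure subgroup of `H`: `n G = G ∩ n H` for every integer `n`. -/
def IsPureSubgroup {H : Type u} [AddCommGroup H] (G : AddSubgroup H) : Prop :=
  ∀ n : ℤ, {x : H | ∃ g ∈ G, n • g = x} = (G : Set H) ∩ {x : H | ∃ h : H, n • h = x}

/-! ### Classes of abelian groups with a strong subgroup relation, and Galois types -/

/-- A pair `𝐊 = (K, ≤_𝐊)` consisting of a class `K` of abelian groups and a relation `≤_𝐊`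
between subgroups of a group and the group. These are the data of an abstract elementary class
in the language of abelian groups; Galois types and tameness are defined from
these data alone. -/
structure GroupClass where
  /-- `Mem G` says that `G ∈ K`. -/
  Mem : ∀ (G : Type u) [AddCommGroup G], Prop
  /-- For a subgroup `G` of `H`, `Le G` says that `G ≤_𝐊 H`. -/
  Le : ∀ {H : Type u} [AddCommGroup H], AddSubgroup H → Prop

namespace GroupClass

/-- `f : M → N` is a `𝐊`-embedding: an isomorphism onto its image `f[M]`, where
`f[M] ≤_𝐊 N`. -/
def IsEmbedding (K : GroupClass.{u}) {M N : Type u} [AddCommGroup M] [AddCommGroup N]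
    (f : M →+ N) : Prop :=
  Function.Injective f ∧ K.Le f.range

/-- A triple `(b, A, N)` with `N ∈ K`, `A ⊆ |N|` and `b ∈ N`. The set of parameters is a fixed
type `A`, and the inclusion `A ⊆ |N|` is an injection of `A` into `N`. -/
structure Triple (K : GroupClass.{u}) (A : Type u) where
  /-- The group `N`. -/
  N : Type u
  [grp : AddCommGroup N]
  mem : K.Mem N
  /-- The inclusion of the parameter set in `N`. -/
  incl : A ↪ N
  /-- The element `b`. -/
  b : N

attribute [instance] Triple.grp

variable {K : GroupClass.{u}} {A : Type u}

/-- The relation `E_at` between triples over the same parameter set `A`: both groups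
`𝐊`-embed into some `N ∈ K` in such a way that the embeddings agree on `A` and
send the two distinguished elements to the same element. -/
def EAt (s t : Triple K A) : Prop :=
  ∃ (N : Type u) (_ : AddCommGroup N) (f : s.N →+ N) (g : t.N →+ N),
    K.Mem N ∧ K.IsEmbedding f ∧ K.IsEmbedding g ∧
      (∀ a : A, f (s.incl a) = g (t.incl a)) ∧ f s.b = g t.b

/-- The relation `E`: the transitive closure of `E_at`. -/
def E : Triple K A → Triple K A → Prop :=
  Relation.TransGen EAt

/-- The Galois type `gtp(b / A; N)`: the `E`-class of the triple `(b, A, N)`. -/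
def gtp (t : Triple K A) : Set (Triple K A) :=
  {s | E t s}

/-- The triple `(b, B, N)` obtained from `(b, A, N)` for `B ⊆ A`. -/
def Triple.restrict (t : Triple K A) (B : Set A) : Triple K B where
  N := t.N
  mem := t.mem
  incl := (Function.Embedding.subtype (· ∈ B)).trans t.incl
  b := t.b

/-- The restriction `p ↾ B` of a Galois type `p = gtp(b / A; N)` to `B ⊆ A`, that is,
`gtp(b / B; N)`. It is written as the set of the triples that are `E`-equivalent to `(b, B, N)`
for some representative `(b, A, N)` of `p`; see `restrictType_gtp`. -/
def restrictType (p : Set (Triple K A)) (B : Set A) : Set (Triple K B) :=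
  {s | ∃ t ∈ p, E (t.restrict B) s}

theorem E.restrict {s t : Triple K A} (h : E s t) (B : Set A) :
    E (s.restrict B) (t.restrict B) := by
  refine Relation.TransGen.lift (p := EAt) (fun t : Triple K A => t.restrict B) ?_ _ _ h
  rintro s t ⟨N, i, f, g, hN, hf, hg, hA, hb⟩
  exact ⟨N, i, f, g, hN, hf, hg, fun a => hA a, hb⟩

/-- When `≤_𝐊` is reflexive, restriction of Galois types does not depend on representatives. -/
theorem restrictType_gtp
    (hrefl : ∀ (H : Type u) [AddCommGroup H], K.Mem H → K.Le (⊤ : AddSubgroup H))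
    (t : Triple K A) (B : Set A) : restrictType (gtp t) B = gtp (t.restrict B) := by
  ext s
  constructor
  · rintro ⟨t', ht', hs⟩
    exact Relation.TransGen.trans (E.restrict ht' B) hs
  · intro hs
    have hid : K.IsEmbedding (AddMonoidHom.id t.N) := by
      refine ⟨Function.injective_id, ?_⟩
      have h : (AddMonoidHom.id t.N).range = ⊤ :=
        AddMonoidHom.range_eq_top.2 Function.surjective_id
      rw [h]
      exact hrefl t.N t.mem
    exact ⟨t, Relation.TransGen.single
      ⟨t.N, t.grp, AddMonoidHom.id _, AddMonoidHom.id _, t.mem, hid, hid, fun _ => rfl, rfl⟩, hs⟩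

/-- `gS(M)`: the set of the Galois types `gtp(b / M; N)` with `M ≤_𝐊 N` and `b ∈ N`, the
extension `M ≤_𝐊 N` being a `𝐊`-embedding of `M` into `N ∈ K`. -/
def gS (K : GroupClass.{u}) (M : Type u) [AddCommGroup M] : Set (Set (Triple K M)) :=
  {p | ∃ (N : Type u) (_ : AddCommGroup N) (hN : K.Mem N) (f : M →+ N)
    (hf : K.IsEmbedding f) (b : N), p = gtp ⟨N, hN, ⟨f, hf.1⟩, b⟩}

/-- `𝐊` is `(<κ, θ)`-tame: for every `M ∈ K` of cardinality `θ`, any two distinct types in `gS(M)`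
have distinct restrictions to some subset of `M` of cardinality less than `κ`. -/
def IsTame (K : GroupClass.{u}) (κ θ : Cardinal.{u}) : Prop :=
  ∀ (M : Type u) [AddCommGroup M], K.Mem M → #M = θ →
    ∀ p ∈ K.gS M, ∀ q ∈ K.gS M, p ≠ q →
      ∃ B : Set M, #B < κ ∧ restrictType p B ≠ restrictType q B

end GroupClass

/-! ### The class `𝐊₂(p₁, p₂, κ)` -/

/-- `K₂(κ)`: torsion-free abelian groups `G` with `|p₁^ω G| ≤ κ` and `|p₂^ω G| ≤ κ`. -/
def K2Mem (p₁ p₂ : ℕ) (κ : Cardinal.{u}) (G : Type u) [AddCommGroup G] : Prop :=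
  IsAddTorsionFree G ∧ #(pOmega p₁ G) ≤ κ ∧ #(pOmega p₂ G) ≤ κ

/-- The pair `𝐊₂(p₁, p₂, κ)`: `G ≤ H` is strong for groups `G, H ∈ K₂(κ)` when `G` is pure in `H`,
`p₁^ω G = p₁^ω H`, and either `p₂^ω G = p₁^ω G` or `p₂^ω G = p₂^ω H`. -/
def K2 (p₁ p₂ : ℕ) (κ : Cardinal.{u}) : GroupClass.{u} where
  Mem G _ := K2Mem p₁ p₂ κ G
  Le {H} _ G := K2Mem p₁ p₂ κ G ∧ K2Mem p₁ p₂ κ H ∧ IsPureSubgroup G ∧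
    pOmegaSub p₁ G = pOmega p₁ H ∧
    (pOmegaSub p₂ G = pOmegaSub p₁ G ∨ pOmegaSub p₂ G = pOmega p₂ H)

/-! ### Measurable cardinals -/

/-- `κ` is a measurable cardinal: it is uncountable and a set of cardinality `κ` carries
a nonprincipal `κ`-complete ultrafilter. -/
def IsMeasurableCardinal (κ : Cardinal.{u}) : Prop :=
  ℵ₀ < κ ∧ ∃ (X : Type u) (U : Ultrafilter X), #X = κ ∧ (∀ x : X, U ≠ pure x) ∧
    CardinalInterFilter (U : Filter X) κ

/-
Let `A` be a subgroup of a slender group `R` such that `R` is divisible by `p₁` and `p₂`, while `A`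
is divisible by `p₂` and `p₁^ω A = 0`. Fix a `μ`-complete filter `l` on `μ` that contains the
cofinite sets, and let `E` be the group of the families in `R ^ μ` that lie in `A` `l`-almost
everywhere. For a nonzero `e ∈ A`, the pairs `(e, 0)` and `(e, e)` in `E × R`, the first
components being constant families, are compared over the pairs `(x, r)` with `x = 0` almost
everywhere. Fewer than `μ` such parameters vanish together at some `i`, and the shear
`(x, r) ↦ (x, r + x i)` fixes them and moves `(e, 0)` to `(e, e)`. If the types over all parameters
were equal, then purity and the conditions on `p₁^ω` and `p₂^ω` would yield a homomorphism from `E`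
to `R` that kills the families vanishing almost everywhere, but not the constant `e`. By a theorem
of Łoś there is none, since below the first measurable cardinal a homomorphism from `ℤ ^ μ` to a
slender group is determined by its values on the unit vectors.
-/

open Filter Function

/-- A type is Ulam measurable if it carries a nonprincipal countably complete ultrafilter. Łoś's
theorem on `ℤ ^ I` is about index types without this property. -/
def IsUlamMeasurable (I : Type*) : Prop :=
  ∃ U : Ultrafilter I, CountableInterFilter (U : Filter I) ∧ ∀ i, U ≠ pure i

theorem eq_pure_of_singleton_mem {X : Type*} {U : Ultrafilter X} {x : X} (hx : {x} ∈ U) :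
    U = pure x :=
  Ultrafilter.eq_of_le (by simpa using hx)

theorem exists_eq_pure_of_countable {X : Type*} [Countable X] (U : Ultrafilter X)
    [CountableInterFilter (U : Filter X)] : ∃ x, U = pure x := by
  by_contra! hU
  have hempty : (⋂ x, {x}ᶜ : Set X) ∈ (U : Filter X) := countable_iInter_mem.2 fun x =>
    Ultrafilter.compl_mem_iff_notMem.2 fun hx => hU x (eq_pure_of_singleton_mem hx)
  obtain ⟨x, hx⟩ := U.nonempty_of_mem hempty
  exact Set.mem_iInter.1 hx x rfl

theorem cardinalInterFilter_of_map_eq_pure {X : Type u} {κ : Cardinal.{u}} (hκ : ℵ₀ ≤ κ)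
    (U : Ultrafilter X) (hU : ∀ (Y : Type u) (g : X → Y), #Y < κ → ∃ y, U.map g = pure y) :
    CardinalInterFilter (U : Filter X) κ := by
  refine ⟨fun S hS hmem => ?_⟩
  have hmiss : ∀ x, ∃ o : Option S, (o = none → x ∈ ⋂₀ S) ∧ ∀ s, o = some s → x ∉ s.1 := by
    intro x
    by_cases hx : x ∈ ⋂₀ S
    · exact ⟨none, fun _ => hx, by simp⟩
    · obtain ⟨s, hs, hxs⟩ := by simpa only [Set.mem_sInter, not_forall] using hx
      exact ⟨some ⟨s, hs⟩, by simp, by rintro _ ⟨⟩; exact hxs⟩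
  choose g hg_none hg_some using hmiss
  have hcard : #(Option S) < κ := by
    rw [Cardinal.mk_option]
    exact Cardinal.add_lt_of_lt hκ hS (one_lt_aleph0.trans_le hκ)
  obtain ⟨o, ho⟩ := hU _ g hcard
  have hfiber : g ⁻¹' {o} ∈ U := by
    rw [← Ultrafilter.mem_map, ho]
    exact Ultrafilter.mem_pure.2 rfl
  cases o with
  | none => exact mem_of_superset hfiber hg_none
  | some s =>
    obtain ⟨x, hx, hxs⟩ := U.nonempty_of_mem (inter_mem hfiber (hmem s.1 s.2))
    exact absurd hxs (hg_some x s hx)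

theorem IsUlamMeasurable.exists_isMeasurableCardinal_le {I : Type u} (hI : IsUlamMeasurable I) :
    ∃ κ : Cardinal.{u}, IsMeasurableCardinal κ ∧ κ ≤ #I := by
  obtain ⟨U, hU, hpure⟩ := hI
  let P : Set Cardinal.{u} :=
    {κ | ∃ (X : Type u) (f : I → X), #X = κ ∧ ∀ x, U.map f ≠ pure x}
  have hIP : #I ∈ P := ⟨I, id, rfl, by simpa using hpure⟩
  obtain ⟨X, f, hX, hf⟩ : sInf P ∈ P := csInf_mem ⟨_, hIP⟩
  have hunc : ℵ₀ < sInf P := by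
    by_contra! hle
    have : Countable X := Cardinal.mk_le_aleph0_iff.1 (hX.trans_le hle)
    have : CountableInterFilter (U.map f : Filter X) := by
      rw [Ultrafilter.coe_map]
      infer_instance
    obtain ⟨x, hx⟩ := exists_eq_pure_of_countable (U.map f)
    exact hf x hx
  refine ⟨sInf P, ⟨hunc, X, U.map f, hX, hf, ?_⟩, csInf_le' hIP⟩
  refine cardinalInterFilter_of_map_eq_pure hunc.le _ fun Y g hY => ?_
  by_contra! hne
  exact notMem_of_lt_csInf' hY ⟨Y, g ∘ f, rfl, by simpa using hne⟩

theorem exists_ultrafilter_eq_inf_principal {I : Type*} (l : Filter I) [l.NeBot]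
    (hl : ∀ T : ℕ → Set I, Pairwise (Disjoint on T) → ∃ n, (T n)ᶜ ∈ l) :
    ∃ (S : Set I) (U : Ultrafilter I), (U : Filter I) = l ⊓ 𝓟 S := by
  obtain ⟨S, hS, hsplit⟩ : ∃ S, Sᶜ ∉ l ∧ ∀ T ⊆ S, Tᶜ ∈ l ∨ (S \ T)ᶜ ∈ l := by
    by_contra! hex
    choose f hf_sub hf hf_diff using hex
    have huniv : Set.univᶜ ∉ l := by simp [empty_notMem]
    let s : ℕ → {S : Set I // Sᶜ ∉ l} := fun n =>
      Nat.rec ⟨Set.univ, huniv⟩ (fun _ S => ⟨f S.1 S.2, hf S.1 S.2⟩) n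
    have hanti : Antitone fun n => (s n).1 :=
      antitone_nat_of_succ_le fun n => hf_sub (s n).1 (s n).2
    obtain ⟨n, hn⟩ := hl (fun n => (s n).1 \ (s (n + 1)).1) <|
      (pairwise_disjoint_on _).2 fun m n hmn =>
        Set.disjoint_left.2 fun i hi hi' => hi.2 (hanti hmn hi'.1)
    exact hf_diff (s n).1 (s n).2 hn
  refine ⟨S, Ultrafilter.ofComplNotMemIff (l ⊓ 𝓟 S) fun T => ?_, rfl⟩
  have hT : T ∈ l ⊓ 𝓟 S ↔ (S \ T)ᶜ ∈ l := by
    rw [mem_inf_principal', sdiff_eq, compl_inf, compl_compl]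
    rfl
  have hTc : Tᶜ ∈ l ⊓ 𝓟 S ↔ (S ∩ T)ᶜ ∈ l := by
    rw [Set.compl_inter, mem_inf_principal', Set.union_comm]
  rw [hT, hTc]
  refine ⟨fun h => ?_, fun h h' => hS ?_⟩
  · simpa using (hsplit (S ∩ T) Set.inter_subset_left).resolve_left h
  · rw [← Set.inter_union_sdiff S T, Set.compl_union]
    exact inter_mem h' h

/-- An abelian group `A` is slender if every homomorphism from the Baer–Specker group `ℤ ^ ℕ` to
`A` kills all but finitely many unit vectors. -/
def IsSlender (A : Type*) [AddCommGroup A] : Prop :=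
  ∀ h : (ℕ → ℤ) →+ A, ∀ᶠ n in cofinite, h (Pi.single n 1) = 0

section Slender

variable {I A : Type*} [AddCommGroup A]

theorem map_ne_zero_of_not_divisible [IsAddTorsionFree A] (h : (ℕ → ℤ) →+ A) {x : ℕ → ℤ} {n : ℕ}
    {m : ℤ} (hn : x n ≠ 0) (hm : ∀ b, m • b ≠ h (Pi.single n 1))
    (hx : ∀ k ≠ n, x n * m ∣ x k) : h x ≠ 0 := by
  have hdvd : ∀ k, x n * m ∣ (x - x n • Pi.single n 1 : ℕ → ℤ) k := by
    intro k
    rcases eq_or_ne k n with rfl | hk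
    · simp
    · simpa [hk] using hx k hk
  choose z hz using hdvd
  have hxz : x = x n • (Pi.single n 1 + m • z) := by
    ext k
    have := hz k
    simp only [Pi.sub_apply, Pi.add_apply, Pi.smul_apply, smul_eq_mul] at this ⊢
    linarith
  rw [hxz, map_zsmul, map_add, map_zsmul]
  refine smul_ne_zero hn fun h0 => hm (h (-z)) ?_
  rw [map_neg, smul_neg, eq_neg_of_add_eq_zero_left h0]

theorem injOn_map_indicator_prod [IsAddTorsionFree A] (h : (ℕ → ℤ) →+ A) {D : Set ℕ} {m : ℕ → ℤ}
    (hm0 : ∀ n, m n ≠ 0) (hm : ∀ n ∈ D, ∀ b, m n • b ≠ h (Pi.single n 1)) :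
    Set.InjOn (fun S : Set ℕ => h (S.indicator fun n => ∏ k ∈ Finset.range n, m k)) (𝒫 D) := by
  let c : ℕ → ℤ := fun n => ∏ k ∈ Finset.range n, m k
  have hc0 : ∀ n, c n ≠ 0 := fun n => Finset.prod_ne_zero_iff.2 fun k _ => hm0 k
  have hcdvd : ∀ {n k}, n < k → c n * m n ∣ c k := fun {n k} hnk => by
    rw [← Finset.prod_range_succ]
    exact Finset.prod_dvd_prod_of_subset _ _ _ (Finset.range_mono hnk)
  intro S hS T hT hST
  by_contra hne
  obtain ⟨n, hn, hmin⟩ : ∃ n, ¬ (n ∈ S ↔ n ∈ T) ∧ ∀ k < n, k ∈ S ↔ k ∈ T := by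
    classical
    have hex : ∃ n, ¬ (n ∈ S ↔ n ∈ T) := not_forall.1 fun hiff => hne (Set.ext hiff)
    exact ⟨Nat.find hex, Nat.find_spec hex, fun k hk => not_not.1 (Nat.find_min hex hk)⟩
  have hnD : n ∈ D := by
    by_cases hnS : n ∈ S
    · exact hS hnS
    · exact hT (by tauto)
  have hval : (S.indicator c - T.indicator c) n = c n ∨
      (S.indicator c - T.indicator c) n = -c n := by
    by_cases hnS : n ∈ S <;> simp_all [Set.indicator]
  have hlead : Associated ((S.indicator c - T.indicator c) n) (c n) := by
    rcases hval with hval | hval <;> rw [hval]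
    exact (Associated.refl _).neg_left
  refine map_ne_zero_of_not_divisible h (x := S.indicator c - T.indicator c)
    (hlead.ne_zero_iff.2 (hc0 n)) (hm n hnD) (fun k hk => ?_)
    ((map_sub h _ _).trans (sub_eq_zero.2 hST))
  rw [(hlead.mul_right (m n)).dvd_iff_dvd_left]
  rcases hk.lt_or_gt with hlt | hgt
  · by_cases hkT : k ∈ T <;> simp [hmin k hlt, hkT]
  · refine dvd_sub ?_ ?_ <;> rw [Set.indicator] <;> split_ifs <;> simp [hcdvd hgt]

/-- Sąsiada's theorem. If infinitely many unit vectors `eₙ` survive, choose `mₙ` not dividing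
`h eₙ`; the sums of the vectors `m₀ ⋯ mₙ₋₁ eₙ` over different sets of such `n` have different
images, too many for a countable group. -/
theorem isSlender_of_countable [Countable A] [IsAddTorsionFree A]
    (hA : ∀ a : A, (∀ m : ℤ, m ≠ 0 → ∃ b, m • b = a) → a = 0) : IsSlender A := by
  intro h
  by_contra hD
  let D := {n | h (Pi.single n 1) ≠ 0}
  have hm : ∀ n, ∃ m : ℤ, m ≠ 0 ∧ (n ∈ D → ∀ b, m • b ≠ h (Pi.single n 1)) := by
    intro n
    by_cases hn : n ∈ D
    · have := mt (hA (h (Pi.single n 1))) hn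
      push Not at this
      exact this.imp fun m hm => ⟨hm.1, fun _ => hm.2⟩
    · exact ⟨1, one_ne_zero, fun h => absurd h hn⟩
  choose m hm0 hm using hm
  have hle := Cardinal.mk_le_aleph0_iff.2
    ((Set.injOn_iff_injective.1 (injOn_map_indicator_prod h hm0 hm)).countable)
  rw [Cardinal.mk_powerset] at hle
  have hinf : ℵ₀ ≤ #D := Cardinal.aleph0_le_mk_iff.2 (Set.infinite_coe_iff.2 hD)
  exact ((Cardinal.cantor _).trans_le hle).not_ge hinf

theorem IsSlender.map_eventually_eq_zero (hA : IsSlender A) (h : (I → ℤ) →+ A) (y : ℕ → I → ℤ)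
    (hy : ∀ i, ∀ᶠ n in cofinite, y n i = 0) : ∀ᶠ n in cofinite, h (y n) = 0 := by
  let s : I → Finset ℕ := fun i => (eventually_cofinite.1 (hy i)).toFinset
  let combination : (ℕ → ℤ) →+ (I → ℤ) := AddMonoidHom.pi fun i =>
    ∑ n ∈ s i, y n i • Pi.evalAddMonoidHom (fun _ : ℕ => ℤ) n
  have hsingle : ∀ n, combination (Pi.single n 1) = y n := by
    intro n
    ext i
    simp [combination, s, AddMonoidHom.finsetSum_apply, Pi.single_apply, eq_comm]
  simpa only [AddMonoidHom.comp_apply, hsingle] using hA (h.comp combination)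

/-- The sets `S` such that the values of `x` on `S` determine `h x`. For slender `A` this filter
is countably complete. -/
def determiningFilter (h : (I → ℤ) →+ A) : Filter I where
  sets := {S | ∀ x : I → ℤ, (∀ i ∈ S, x i = 0) → h x = 0}
  univ_sets x hx := by rw [show x = 0 from funext fun i => hx i trivial, map_zero]
  sets_of_superset hS hST x hx := hS x fun i hi => hx i (hST hi)
  inter_sets {S T} hS hT x hx := by
    rw [← Set.indicator_self_add_compl S x, map_add]
    rw [hT _ fun i hi => ?_, hS _ fun i hi => Set.indicator_of_notMem (by simpa using hi) x,
      add_zero]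
    by_cases hiS : i ∈ S
    · rw [Set.indicator_of_mem hiS, hx i ⟨hiS, hi⟩]
    · exact Set.indicator_of_notMem hiS x

variable {h : (I → ℤ) →+ A}

theorem mem_determiningFilter {S : Set I} :
    S ∈ determiningFilter h ↔ ∀ x : I → ℤ, (∀ i ∈ S, x i = 0) → h x = 0 :=
  Iff.rfl

theorem neBot_determiningFilter (hh : h ≠ 0) : (determiningFilter h).NeBot := by
  refine ⟨fun hbot => hh ?_⟩
  ext x
  exact mem_determiningFilter.1 (empty_mem_iff_bot.2 hbot) x (by simp)

theorem compl_singleton_mem_determiningFilter [DecidableEq I] {i : I}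
    (hi : h (Pi.single i 1) = 0) : {i}ᶜ ∈ determiningFilter h := by
  intro x hx
  have hsingle : x = x i • Pi.single i 1 := by
    ext j
    rcases eq_or_ne j i with rfl | hj
    · simp
    · simpa [hj] using hx j hj
  rw [hsingle, map_zsmul, hi, smul_zero]

theorem IsSlender.countableInterFilter_determiningFilter (hA : IsSlender A) :
    CountableInterFilter (determiningFilter h) := by
  refine ⟨fun 𝒮 hcount hmem => ?_⟩
  rcases 𝒮.eq_empty_or_nonempty with rfl | hne
  · simp only [Set.sInter_empty, univ_mem]
  obtain ⟨s, rfl⟩ := hcount.exists_eq_range hne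
  intro x hx
  let G : ℕ → Set I := fun n => ⋂ k ∈ Finset.range n, s k
  have hG : ∀ n, G n ∈ determiningFilter h := fun n =>
    (biInter_finset_mem _).2 fun k _ => hmem _ ⟨k, rfl⟩
  have htail : ∀ i, ∀ᶠ n in cofinite, (G n).indicator x i = 0 := by
    intro i
    by_cases hi : i ∈ ⋂₀ Set.range s
    · exact Eventually.of_forall fun n => Set.indicator_apply_eq_zero.2 fun _ => hx i hi
    · obtain ⟨m, hm⟩ : ∃ m, i ∉ s m := by simpa using hi
      rw [Nat.cofinite_eq_atTop]
      filter_upwards [eventually_gt_atTop m] with n hn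
      refine Set.indicator_of_notMem (fun hiG => hm ?_) x
      exact Set.mem_iInter₂.1 hiG m (Finset.mem_range.2 hn)
  obtain ⟨n, hn⟩ := (hA.map_eventually_eq_zero h _ htail).exists
  rw [← Set.indicator_self_add_compl (G n) x, map_add, hn, zero_add]
  exact hG n _ fun i hi => Set.indicator_of_notMem (by simpa using hi) x

theorem IsSlender.exists_compl_mem_determiningFilter (hA : IsSlender A) {T : ℕ → Set I}
    (hT : Pairwise (Disjoint on T)) : ∃ n, (T n)ᶜ ∈ determiningFilter h := by
  by_contra! hne
  simp only [mem_determiningFilter, not_forall] at hne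
  choose x hx_supp hx using hne
  refine (hA.map_eventually_eq_zero h x fun i => ?_).exists.elim fun n hn => hx n hn
  by_cases hi : ∃ m, i ∈ T m
  · obtain ⟨m, hm⟩ := hi
    refine (eventually_cofinite_ne m).mono fun n hn => hx_supp n i ?_
    exact Set.disjoint_left.1 (hT hn.symm) hm
  · exact Eventually.of_forall fun n => hx_supp n i fun hin => hi ⟨n, hin⟩

/-- Łoś's theorem. The determining filter of a nonzero `h` would restrict to a nonprincipal
countably complete ultrafilter. -/
theorem IsSlender.eq_zero_of_map_single_eq_zero [DecidableEq I] (hA : IsSlender A)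
    (hI : ¬ IsUlamMeasurable I) (hh : ∀ i, h (Pi.single i 1) = 0) : h = 0 := by
  by_contra hne
  have := neBot_determiningFilter hne
  have := hA.countableInterFilter_determiningFilter (h := h)
  obtain ⟨S, U, hU⟩ := exists_ultrafilter_eq_inf_principal (determiningFilter h)
    fun T => hA.exists_compl_mem_determiningFilter
  refine hI ⟨U, hU ▸ inferInstance, fun i hi => ?_⟩
  have hmem : {i}ᶜ ∈ (U : Filter I) :=
    hU ▸ mem_inf_of_left (compl_singleton_mem_determiningFilter (hh i))
  simp [hi] at hmem

end Slender

section POmega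

variable {p : ℕ} {G H : Type*} [AddCommGroup G] [AddCommGroup H]

theorem map_mem_pOmega (f : G →+ H) {g : G} (hg : g ∈ pOmega p G) : f g ∈ pOmega p H :=
  mem_pOmega.2 fun n => (mem_pOmega.1 hg n).imp' f fun a ha => by rw [← map_nsmul, ha]

theorem pOmega_prod : pOmega p (G × H) = (pOmega p G).prod (pOmega p H) := by
  refine le_antisymm (fun x hx => ?_) fun x hx => mem_pOmega.2 fun n => ?_
  · exact ⟨map_mem_pOmega (AddMonoidHom.fst G H) hx, map_mem_pOmega (AddMonoidHom.snd G H) hx⟩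
  · obtain ⟨a, ha⟩ := mem_pOmega.1 hx.1 n
    obtain ⟨b, hb⟩ := mem_pOmega.1 hx.2 n
    exact ⟨(a, b), Prod.ext ha hb⟩

theorem pOmega_eq_bot_of_injective {f : G →+ H} (hf : Injective f) (hH : pOmega p H = ⊥) :
    pOmega p G = ⊥ :=
  (AddSubgroup.eq_bot_iff_forall _).2 fun _ hg =>
    (map_eq_zero_iff f hf).1 ((AddSubgroup.eq_bot_iff_forall _).1 hH _ (map_mem_pOmega f hg))

theorem pOmega_eq_top_of_surjective {f : G →+ H} (hf : Surjective f) (hG : pOmega p G = ⊤) :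
    pOmega p H = ⊤ := by
  refine (AddSubgroup.eq_top_iff' _).2 (hf.forall.2 fun _ => map_mem_pOmega f ?_)
  rw [hG]
  trivial

theorem pOmega_int_eq_bot (hp : p ≠ 1) : pOmega p ℤ = ⊥ := by
  refine (AddSubgroup.eq_bot_iff_forall _).2 fun x hx => by_contra fun hx0 => ?_
  have hfin : FiniteMultiplicity (p : ℤ) x :=
    Int.finiteMultiplicity_iff.2 ⟨by simpa using hp, hx0⟩
  refine FiniteMultiplicity.not_iff_forall.2 (fun n => ?_) hfin
  obtain ⟨y, hy⟩ := mem_pOmega.1 hx n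
  exact ⟨y, by simpa using hy.symm⟩

theorem pOmega_finsupp_int_eq_bot {J : Type*} (hp : p ≠ 1) : pOmega p (J →₀ ℤ) = ⊥ := by
  refine (AddSubgroup.eq_bot_iff_forall _).2 fun x hx => Finsupp.ext fun j => ?_
  obtain h := mem_pOmega.1 hx
  refine (AddSubgroup.eq_bot_iff_forall _).1 (pOmega_int_eq_bot hp) (x j) (mem_pOmega.2 fun n => ?_)
  exact (h n).imp' (· j) fun y hy => by rw [← hy, Finsupp.smul_apply]

theorem comap_pOmega_of_isPureSubgroup_range {f : G →+ H} (hf : Injective f)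
    (hpure : IsPureSubgroup f.range) : (pOmega p H).comap f = pOmega p G := by
  refine le_antisymm (fun g hg => mem_pOmega.2 fun n => ?_) fun _ => map_mem_pOmega f
  obtain ⟨a, ha⟩ := mem_pOmega.1 hg n
  obtain ⟨_, ⟨b, rfl⟩, hb⟩ : f g ∈ {x | ∃ y ∈ f.range, ((p ^ n : ℕ) : ℤ) • y = x} :=
    hpure _ ▸ ⟨⟨g, rfl⟩, a, (natCast_zsmul a _).trans ha⟩
  exact ⟨b, hf (by rw [map_nsmul, ← hb, natCast_zsmul])⟩

theorem pOmegaSub_of_isPureSubgroup {S : AddSubgroup H} (hS : IsPureSubgroup S) :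
    pOmegaSub p S = S ⊓ pOmega p H := by
  rw [pOmegaSub, ← comap_pOmega_of_isPureSubgroup_range S.subtype_injective
    (S.range_subtype.symm ▸ hS), AddSubgroup.map_comap_eq, S.range_subtype]

theorem isPureSubgroup_of_nsmulSaturated {S : AddSubgroup H} (hS : S.NSMulSaturated) :
    IsPureSubgroup S := by
  intro n
  ext x
  constructor
  · rintro ⟨g, hg, rfl⟩
    exact ⟨S.zsmul_mem hg n, g, rfl⟩
  · rintro ⟨hx, y, rfl⟩
    rcases AddSubgroup.saturated_iff_zsmul.1 hS n y hx with rfl | hy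
    · exact ⟨0, S.zero_mem, by simp⟩
    · exact ⟨y, hy, rfl⟩

end POmega

namespace GroupClass

variable {K : GroupClass.{u}} {A M N : Type u} [AddCommGroup M] [AddCommGroup N]

theorem isEmbedding_subtype {S : AddSubgroup N} (hS : K.Le S) : K.IsEmbedding S.subtype :=
  ⟨S.subtype_injective, S.range_subtype.symm ▸ hS⟩

theorem isEmbedding_addEquiv (hN : K.Le (⊤ : AddSubgroup N)) (e : M ≃+ N) :
    K.IsEmbedding (e : M →+ N) :=
  ⟨e.injective, (AddMonoidHom.range_eq_top (f := (e : M →+ N)).2 e.surjective).symm ▸ hN⟩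

theorem EAt.symm {s t : Triple K A} : EAt s t → EAt t s :=
  fun ⟨N, _, f, g, hN, hf, hg, hA, hb⟩ => ⟨N, _, g, f, hN, hg, hf, fun a => (hA a).symm, hb.symm⟩

theorem gtp_eq_gtp_of_EAt {s t : Triple K A} (h : EAt s t) : gtp s = gtp t :=
  Set.ext fun _ => ⟨fun hs => .head h.symm hs, fun ht => .head h ht⟩

theorem EAt.of_addEquiv {s : Triple K A} {c : s.N} (hs : K.Le (⊤ : AddSubgroup s.N))
    (σ : s.N ≃+ s.N) (hincl : ∀ a, σ (s.incl a) = s.incl a) (hb : σ s.b = c) :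
    EAt s ⟨s.N, s.mem, s.incl, c⟩ :=
  ⟨s.N, s.grp, σ, AddEquiv.refl s.N, s.mem, isEmbedding_addEquiv hs σ,
    isEmbedding_addEquiv hs (AddEquiv.refl s.N), hincl, hb⟩

theorem IsTame.E_of_conjugate
    (hrefl : ∀ (H : Type u) [AddCommGroup H], K.Mem H → K.Le (⊤ : AddSubgroup H))
    {κ : Cardinal.{u}} (hK : K.IsTame κ #M) (hM : K.Mem M) (hN : K.Mem N) {f : M →+ N}
    (hf : K.IsEmbedding f) {b c : N}
    (hconj : ∀ B : Set M, #B < κ → ∃ σ : N ≃+ N, (∀ x ∈ B, σ (f x) = f x) ∧ σ b = c) :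
    E (K := K) ⟨N, hN, ⟨f, hf.1⟩, b⟩ ⟨N, hN, ⟨f, hf.1⟩, c⟩ := by
  let s : Triple K M := ⟨N, hN, ⟨f, hf.1⟩, b⟩
  let t : Triple K M := ⟨N, hN, ⟨f, hf.1⟩, c⟩
  have htypes : gtp s = gtp t := by
    by_contra hne
    obtain ⟨B, hB, hres⟩ := hK M hM rfl (gtp s) ⟨N, _, hN, f, hf, b, rfl⟩
      (gtp t) ⟨N, _, hN, f, hf, c, rfl⟩ hne
    obtain ⟨σ, hσ, hσb⟩ := hconj B hB
    refine hres ?_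
    rw [restrictType_gtp hrefl, restrictType_gtp hrefl]
    exact gtp_eq_gtp_of_EAt (EAt.of_addEquiv (s := s.restrict B) (hrefl N hN) σ
      (fun a => hσ a a.2) hσb)
  have ht : t ∈ gtp t :=
    .single (EAt.of_addEquiv (s := t) (hrefl N hN) (AddEquiv.refl N) (fun _ => rfl) rfl)
  rwa [← htypes] at ht

/-- Some homomorphism `p^ω N₁ → p^ω N₂` sends every parameter and the distinguished element of the
first triple, as far as they lie in `p^ω N₁`, to those of the second. -/
def Triple.HasPOmegaHom (p : ℕ) (s t : Triple K A) : Prop :=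
  ∃ φ : pOmega p s.N →+ pOmega p t.N, (∀ x : pOmega p s.N, (x : s.N) = s.b → (φ x : t.N) = t.b) ∧
    ∀ (a : A) (x : pOmega p s.N), (x : s.N) = s.incl a → (φ x : t.N) = t.incl a

theorem Triple.HasPOmegaHom.trans {p : ℕ} {s t r : Triple K A} :
    s.HasPOmegaHom p t → t.HasPOmegaHom p r → s.HasPOmegaHom p r :=
  fun ⟨φ, hφb, hφ⟩ ⟨ψ, hψb, hψ⟩ => ⟨ψ.comp φ, fun x hx => hψb _ (hφb x hx),
    fun a x hx => hψ a _ (hφ a x hx)⟩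

theorem Triple.hasPOmegaHom_of_le_range {p : ℕ} {s t : Triple K A} {f : s.N →+ N} {g : t.N →+ N}
    (hg : Injective g) (hincl : ∀ a, f (s.incl a) = g (t.incl a)) (hb : f s.b = g t.b)
    (hcomap : (pOmega p N).comap g = pOmega p t.N) (hrange : pOmega p N ≤ g.range) :
    s.HasPOmegaHom p t := by
  have hlift : ∀ x : pOmega p s.N, ∃ y : pOmega p t.N, g y = f x := by
    intro x
    have hx := map_mem_pOmega f x.2
    obtain ⟨y, hy⟩ := hrange hx
    exact ⟨⟨y, hcomap ▸ AddSubgroup.mem_comap.2 (hy.symm ▸ hx)⟩, hy⟩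
  choose φ hφ using hlift
  refine ⟨AddMonoidHom.mk' φ fun x y => Subtype.ext (hg ?_), fun x hx => hg ?_,
    fun a x hx => hg ?_⟩
  · simp only [hφ, AddSubgroup.coe_add, map_add]
  · simp only [AddMonoidHom.mk'_apply, hφ, hx, hb]
  · simp only [AddMonoidHom.mk'_apply, hφ, hx, hincl]

end GroupClass

section K2

open GroupClass

variable {p₁ p₂ : ℕ} {κ : Cardinal.{u}} {A G H : Type u} [AddCommGroup G] [AddCommGroup H]

theorem K2Mem.of_injective (hH : K2Mem p₁ p₂ κ H) {f : G →+ H} (hf : Injective f) :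
    K2Mem p₁ p₂ κ G := by
  obtain ⟨_, h₁, h₂⟩ := hH
  have hle : ∀ p, #(pOmega p G) ≤ #(pOmega p H) := fun p =>
    Cardinal.mk_le_of_injective (f := fun x => ⟨f x, map_mem_pOmega f x.2⟩)
      fun x y hxy => Subtype.ext (hf (congrArg Subtype.val hxy))
  exact ⟨hf.isAddTorsionFree f, (hle p₁).trans h₁, (hle p₂).trans h₂⟩

theorem K2_le_of_inf_pOmega_eq (hH : K2Mem p₁ p₂ κ H) {S : AddSubgroup H} (hS : IsPureSubgroup S)
    (hω : S ⊓ pOmega p₂ H = pOmega p₁ H) : (K2 p₁ p₂ κ).Le S := by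
  have h₁ : pOmegaSub p₁ S = pOmega p₁ H := by
    rw [pOmegaSub_of_isPureSubgroup hS, inf_eq_right, ← hω]
    exact inf_le_left
  refine ⟨hH.of_injective S.subtype_injective, hH, hS, h₁, Or.inl ?_⟩
  rw [pOmegaSub_of_isPureSubgroup hS, hω, h₁]

theorem K2_le_top (H : Type u) [AddCommGroup H] (hH : (K2 p₁ p₂ κ).Mem H) :
    (K2 p₁ p₂ κ).Le (⊤ : AddSubgroup H) := by
  have hpure : IsPureSubgroup (⊤ : AddSubgroup H) :=
    isPureSubgroup_of_nsmulSaturated fun _ _ _ => Or.inr trivial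
  have hω : ∀ p, pOmegaSub p (⊤ : AddSubgroup H) = pOmega p H := fun p => by
    rw [pOmegaSub_of_isPureSubgroup hpure, top_inf_eq]
  exact ⟨K2Mem.of_injective hH (AddSubgroup.subtype_injective _), hH, hpure, hω p₁, Or.inr (hω p₂)⟩

theorem K2_comap_pOmega {f : G →+ H} (hf : (K2 p₁ p₂ κ).IsEmbedding f) (p : ℕ) :
    (pOmega p H).comap f = pOmega p G :=
  comap_pOmega_of_isPureSubgroup_range hf.1 hf.2.2.2.1

theorem GroupClass.EAt.mem_pOmega_iff {s t : Triple (K2 p₁ p₂ κ) A} (h : EAt s t) (p : ℕ) :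
    s.b ∈ pOmega p s.N ↔ t.b ∈ pOmega p t.N := by
  obtain ⟨N, _, f, g, -, hf, hg, -, hb⟩ := h
  rw [← K2_comap_pOmega hf, ← K2_comap_pOmega hg, AddSubgroup.mem_comap, hb,
    AddSubgroup.mem_comap]

theorem GroupClass.EAt.hasPOmegaHom {s t : Triple (K2 p₁ p₂ κ) A} (h : EAt s t)
    (hb₂ : s.b ∈ pOmega p₂ s.N) (hb₁ : s.b ∉ pOmega p₁ s.N) : s.HasPOmegaHom p₂ t := by
  rw [EAt.mem_pOmega_iff h] at hb₁ hb₂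
  obtain ⟨N, _, f, g, -, hf, hg, hincl, hb⟩ := h
  refine Triple.hasPOmegaHom_of_le_range hg.1 hincl hb (K2_comap_pOmega hg p₂) ?_
  have hpure : IsPureSubgroup g.range := hg.2.2.2.1
  rw [← inf_eq_right, ← pOmegaSub_of_isPureSubgroup hpure]
  refine hg.2.2.2.2.2.resolve_left fun heq => hb₁ ?_
  rw [← K2_comap_pOmega hg] at hb₂ ⊢
  rw [pOmegaSub_of_isPureSubgroup hpure, pOmegaSub_of_isPureSubgroup hpure] at heq
  have hgb : g t.b ∈ g.range ⊓ pOmega p₂ N := ⟨⟨t.b, rfl⟩, hb₂⟩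
  exact (heq ▸ hgb).2

theorem GroupClass.E.hasPOmegaHom {s t : Triple (K2 p₁ p₂ κ) A} (h : E s t)
    (hb₂ : s.b ∈ pOmega p₂ s.N) (hb₁ : s.b ∉ pOmega p₁ s.N) : s.HasPOmegaHom p₂ t := by
  induction h using Relation.TransGen.head_induction_on with
  | single h => exact EAt.hasPOmegaHom h hb₂ hb₁
  | head h _ ih =>
    refine (EAt.hasPOmegaHom h hb₂ hb₁).trans ?_
    rw [EAt.mem_pOmega_iff h] at hb₁ hb₂
    exact ih hb₂ hb₁

end K2

/-- The rational numbers whose denominator is coprime to `n`, the source of test groups with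
prescribed divisibility. -/
def ratCoprimeDen (n : ℕ) : AddSubgroup ℚ where
  carrier := {x | x.den.Coprime n}
  zero_mem' := Nat.coprime_one_left n
  add_mem' hx hy := (Nat.Coprime.mul_left hx hy).coprime_dvd_left (Rat.add_den_dvd _ _)
  neg_mem' hx := hx

section RatCoprimeDen

variable {m n : ℕ}

theorem ratCoprimeDen_anti (hmn : m ∣ n) : ratCoprimeDen n ≤ ratCoprimeDen m :=
  fun _ hx => Nat.Coprime.coprime_dvd_right hmn hx

theorem one_mem_ratCoprimeDen : (1 : ℚ) ∈ ratCoprimeDen n :=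
  Nat.coprime_one_left n

theorem div_mem_ratCoprimeDen (hmn : m.Coprime n) {x : ℚ} (hx : x ∈ ratCoprimeDen n) :
    x / m ∈ ratCoprimeDen n := by
  have hinv : (m : ℚ)⁻¹.den ∣ m := by
    rw [Rat.inv_natCast_den]
    split_ifs <;> simp
  rw [div_eq_mul_inv]
  exact (Nat.Coprime.mul_left hx (hmn.coprime_dvd_left hinv)).coprime_dvd_left (Rat.mul_den_dvd _ _)

theorem pOmega_ratCoprimeDen_eq_top (hm : m ≠ 0) (hmn : m.Coprime n) :
    pOmega m (ratCoprimeDen n) = ⊤ := by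
  refine (AddSubgroup.eq_top_iff' _).2 fun x => mem_pOmega.2 fun k => ?_
  refine ⟨⟨x / (m ^ k : ℕ), div_mem_ratCoprimeDen (hmn.pow_left k) x.2⟩, Subtype.ext ?_⟩
  have hmk : ((m ^ k : ℕ) : ℚ) ≠ 0 := by positivity
  simp only [AddSubgroup.coe_nsmul, nsmul_eq_mul]
  exact mul_div_cancel₀ _ hmk

theorem dvd_num_natCast_mul {a b : ℕ} {x : ℚ} (hba : b ∣ a) (hx : x.den.Coprime b) :
    (b : ℤ) ∣ (a * x : ℚ).num := by
  have hnum : (a * x : ℚ).num * x.den = a * (x.num * (a * x : ℚ).den) := by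
    simpa [mul_assoc] using Rat.mul_num_den' a x
  refine (Nat.isCoprime_iff_coprime.2 hx.symm).dvd_of_dvd_mul_right ?_
  rw [hnum]
  exact (Int.natCast_dvd_natCast.2 hba).mul_right _

theorem pOmega_ratCoprimeDen_eq_bot {q : ℕ} (hq : q ≠ 1) (hqm : q ∣ m) (hqn : q ∣ n) :
    pOmega m (ratCoprimeDen n) = ⊥ := by
  refine (AddSubgroup.eq_bot_iff_forall _).2 fun x hx => Subtype.ext (Rat.zero_of_num_zero ?_)
  refine (AddSubgroup.eq_bot_iff_forall _).1 (pOmega_int_eq_bot hq) _ (mem_pOmega.2 fun k => ?_)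
  obtain ⟨y, rfl⟩ := mem_pOmega.1 hx k
  obtain ⟨z, hz⟩ := dvd_num_natCast_mul (pow_dvd_pow_of_dvd hqm k)
    ((y.2.coprime_dvd_right hqn).pow_right k)
  exact ⟨z, by simpa [nsmul_eq_mul] using hz.symm⟩

theorem isSlender_ratCoprimeDen (hn0 : n ≠ 0) (hn : n ≠ 1) : IsSlender (ratCoprimeDen n) := by
  refine isSlender_of_countable fun x hx => ?_
  refine (AddSubgroup.eq_bot_iff_forall _).1
    (pOmega_ratCoprimeDen_eq_bot hn dvd_rfl dvd_rfl) x (mem_pOmega.2 fun k => ?_)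
  exact (hx (n ^ k : ℕ) (by positivity)).imp fun y hy => (natCast_zsmul y _).symm.trans hy

end RatCoprimeDen

/-- The families `x : I → R` with `x i ∈ A` for `l`-almost every `i`. -/
def eventuallyMem {I R : Type*} [AddCommGroup R] (l : Filter I) (A : AddSubgroup R) :
    AddSubgroup (I → R) where
  carrier := {x | ∀ᶠ i in l, x i ∈ A}
  zero_mem' := Eventually.of_forall fun _ => A.zero_mem
  add_mem' hx hy := hx.mp (hy.mono fun _ hy hx => A.add_mem hx hy)
  neg_mem' hx := hx.mono fun _ => A.neg_mem

section EventuallyMem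

variable {I R B : Type*} [AddCommGroup R] [AddCommGroup B] {l : Filter I} {A : AddSubgroup R}

theorem eventuallyMem_mono {A' : AddSubgroup R} (hA : A ≤ A') :
    eventuallyMem l A ≤ eventuallyMem l A' :=
  fun _ hx => Eventually.mono hx fun _ hi => hA hi

/-- Łoś's theorem applies to the homomorphism `c ↦ ψ (c x)` on `ℤ ^ I`. -/
theorem IsSlender.eq_zero_of_eventuallyMem (hB : IsSlender B) (hI : ¬ IsUlamMeasurable I)
    (hl : l ≤ cofinite) (ψ : eventuallyMem l A →+ B)
    (hψ : ∀ x : eventuallyMem l A, (∀ᶠ i in l, x.1 i = 0) → ψ x = 0) : ψ = 0 := by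
  classical
  ext x
  let scale : (I → ℤ) →+ eventuallyMem l A :=
    AddMonoidHom.mk' (fun c => ⟨fun i => c i • x.1 i, x.2.mono fun i hi => A.zsmul_mem hi (c i)⟩)
      fun c d => Subtype.ext <| funext fun i => add_smul (c i) (d i) (x.1 i)
  have hsingle : ∀ i, (ψ.comp scale) (Pi.single i 1) = 0 := fun i => by
    refine hψ _ (((eventually_cofinite_ne i).filter_mono hl).mono fun j hj => ?_)
    simp [scale, Pi.single_eq_of_ne hj]
  have hzero := hB.eq_zero_of_map_single_eq_zero hI hsingle
  have hone : scale 1 = x := by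
    ext i
    simp [scale]
  simpa [hone] using DFunLike.congr_fun hzero 1

end EventuallyMem

section POmegaEventuallyMem

variable {I R : Type*} [AddCommGroup R] {l : Filter I} {A : AddSubgroup R} {p : ℕ}

theorem pOmega_eventuallyMem_eq_top (hR : pOmega p R = ⊤) (hA : pOmega p A = ⊤) :
    pOmega p (eventuallyMem l A) = ⊤ := by
  refine (AddSubgroup.eq_top_iff' _).2 fun x => mem_pOmega.2 fun n => ?_
  have hdiv : ∀ r : R, ∃ s, p ^ n • s = r ∧ (r ∈ A → s ∈ A) := by
    intro r
    by_cases hr : r ∈ A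
    · obtain ⟨s, hs⟩ := mem_pOmega.1 (hA.symm ▸ AddSubgroup.mem_top (⟨r, hr⟩ : A)) n
      exact ⟨s, congrArg Subtype.val hs, fun _ => s.2⟩
    · obtain ⟨s, hs⟩ := mem_pOmega.1 (hR.symm ▸ AddSubgroup.mem_top r) n
      exact ⟨s, hs, fun h => absurd h hr⟩
  choose d hd hdA using hdiv
  exact ⟨⟨fun i => d (x.1 i), x.2.mono fun i hi => hdA _ hi⟩, Subtype.ext (funext fun i => hd _)⟩

theorem pOmega_eventuallyMem [CountableInterFilter l] (hR : pOmega p R = ⊤)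
    (hA : pOmega p A = ⊥) :
    pOmega p (eventuallyMem l A) = (eventuallyMem l ⊥).addSubgroupOf (eventuallyMem l A) := by
  refine le_antisymm (fun x hx => ?_) fun x hx => ?_
  · choose y hy using mem_pOmega.1 hx
    have hy_mem : ∀ᶠ i in l, ∀ n, (y n).1 i ∈ A :=
      eventually_countable_forall.2 fun n => (y n).2
    refine (x.2.and hy_mem).mono fun i ⟨hxi, hyi⟩ => ?_
    have hdiv : (⟨x.1 i, hxi⟩ : A) ∈ pOmega p A :=
      mem_pOmega.2 fun n =>
        ⟨⟨(y n).1 i, hyi n⟩, Subtype.ext (congrFun (congrArg Subtype.val (hy n)) i)⟩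
    rw [hA, AddSubgroup.mem_bot] at hdiv
    exact congrArg Subtype.val hdiv
  · have htop : pOmega p (eventuallyMem l (⊥ : AddSubgroup R)) = ⊤ :=
      pOmega_eventuallyMem_eq_top hR (Subsingleton.elim _ _)
    have hmem : (⟨x.1, hx⟩ : eventuallyMem l (⊥ : AddSubgroup R)) ∈ pOmega p _ :=
      htop ▸ trivial
    exact map_mem_pOmega (AddSubgroup.inclusion (eventuallyMem_mono bot_le)) hmem

end POmegaEventuallyMem

theorem aleph0_le_two_power (I : Type u) [Infinite I] : ℵ₀ ≤ (2 : Cardinal.{u}) ^ #I :=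
  (Cardinal.aleph0_le_mk I).trans (Cardinal.cantor _).le

theorem mk_arrow_le_two_power (I : Type u) [Infinite I] (R : Type) [Countable R] :
    #(I → R) ≤ 2 ^ #I := by
  have hR : lift.{u} #R ≤ ℵ₀ := by simp
  calc #(I → R) = lift.{u} #R ^ #I := by rw [Cardinal.mk_arrow, Cardinal.lift_id'.{0}]
    _ ≤ ℵ₀ ^ #I := Cardinal.power_le_power_right hR
    _ = 2 ^ #I :=
      Cardinal.power_eq_two_power (Cardinal.aleph0_le_mk I) Cardinal.ofNat_lt_aleph0.le
        (Cardinal.aleph0_le_mk I)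

/-- The group in which the two types are realized. Its factor `J →₀ ℤ`, which meets neither
`p^ω`, only serves to enlarge it. -/
abbrev TestGroup {I R : Type*} [AddCommGroup R] (l : Filter I) (A : AddSubgroup R) (J : Type*) :
    Type _ :=
  eventuallyMem l A × R × (J →₀ ℤ)

namespace TestGroup

variable {I J : Type u} {R : Type} [AddCommGroup R] {l : Filter I} {A : AddSubgroup R}
  {p p₁ p₂ : ℕ}

/-- The subgroup of `TestGroup l A J` over which the types are taken: the first component vanishes
almost everywhere. -/
noncomputable def base (l : Filter I) (A : AddSubgroup R) (J : Type u) :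
    AddSubgroup (TestGroup l A J) :=
  ((eventuallyMem l ⊥).addSubgroupOf (eventuallyMem l A)).prod ⊤

theorem mem_base {x : TestGroup l A J} : x ∈ base l A J ↔ ∀ᶠ i in l, x.1.1 i = 0 :=
  ⟨fun hx => hx.1, fun hx => ⟨hx, trivial⟩⟩

theorem isPureSubgroup_base [IsAddTorsionFree R] : IsPureSubgroup (base l A J) := by
  refine isPureSubgroup_of_nsmulSaturated fun n x hx => or_iff_not_imp_left.2 fun hn => ?_
  exact mem_base.2 ((mem_base.1 hx).mono fun i hi => (smul_eq_zero.1 hi).resolve_left hn)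

theorem pOmega_eq_prod (hp : p ≠ 1) (hR : pOmega p R = ⊤) :
    pOmega p (TestGroup l A J) = (pOmega p (eventuallyMem l A)).prod (AddSubgroup.prod ⊤ ⊥) := by
  rw [pOmega_prod, pOmega_prod, hR, pOmega_finsupp_int_eq_bot hp]

theorem base_inf_pOmega [CountableInterFilter l] (hp₁ : p₁ ≠ 1) (hp₂ : p₂ ≠ 1)
    (hR₁ : pOmega p₁ R = ⊤) (hR₂ : pOmega p₂ R = ⊤) (hA₁ : pOmega p₁ A = ⊥)
    (hA₂ : pOmega p₂ A = ⊤) :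
    base l A J ⊓ pOmega p₂ (TestGroup l A J) = pOmega p₁ (TestGroup l A J) := by
  rw [pOmega_eq_prod hp₁ hR₁, pOmega_eq_prod hp₂ hR₂, pOmega_eventuallyMem_eq_top hR₂ hA₂,
    pOmega_eventuallyMem hR₁ hA₁]
  ext x
  simp [base, AddSubgroup.mem_prod]

theorem mk_pOmega_le [Infinite I] [Countable R] (hp : p ≠ 1) :
    #(pOmega p (TestGroup l A J)) ≤ 2 ^ #I := by
  have hthird : ∀ x ∈ pOmega p (TestGroup l A J), x.2.2 = 0 := fun x hx =>
    (AddSubgroup.eq_bot_iff_forall _).1 (pOmega_finsupp_int_eq_bot hp) _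
      (map_mem_pOmega (AddMonoidHom.snd R (J →₀ ℤ)) (map_mem_pOmega (AddMonoidHom.snd _ _) hx))
  have hinj : Injective fun x : pOmega p (TestGroup l A J) => (x.1.1.1, x.1.2.1) := by
    intro x y hxy
    simp only [Prod.mk.injEq] at hxy
    refine Subtype.ext (Prod.ext (Subtype.ext hxy.1) (Prod.ext hxy.2 ?_))
    rw [hthird x x.2, hthird y y.2]
  calc #(pOmega p (TestGroup l A J)) ≤ #((I → R) × R) := Cardinal.mk_le_of_injective hinj
    _ = #(I → R) * lift.{u} #R := by rw [Cardinal.mk_prod, Cardinal.lift_id'.{0}]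
    _ ≤ 2 ^ #I := Cardinal.mul_le_of_le (aleph0_le_two_power I) (mk_arrow_le_two_power I R)
      ((by simp : lift.{u} #R ≤ ℵ₀).trans (aleph0_le_two_power I))

theorem K2Mem_testGroup [Infinite I] [Countable R] [IsAddTorsionFree R] (hp₁ : p₁ ≠ 1)
    (hp₂ : p₂ ≠ 1) {κ : Cardinal.{u}} (hκ : 2 ^ #I ≤ κ) : K2Mem p₁ p₂ κ (TestGroup l A J) := by
  have : IsAddTorsionFree (eventuallyMem l A) :=
    (eventuallyMem l A).subtype_injective.isAddTorsionFree (eventuallyMem l A).subtype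
  exact ⟨inferInstance, (mk_pOmega_le hp₁).trans hκ, (mk_pOmega_le hp₂).trans hκ⟩

theorem mk_base [Infinite I] [Countable R] (hJ : 2 ^ #I ≤ #J) : #(base l A J) = #J := by
  refine le_antisymm ?_ ?_
  · have hJ₀ : ℵ₀ ≤ #J := (aleph0_le_two_power I).trans hJ
    have : Infinite J := Cardinal.infinite_iff.2 hJ₀
    have hfst : #(eventuallyMem l A) ≤ #J :=
      (Cardinal.mk_subtype_le _).trans ((mk_arrow_le_two_power I R).trans hJ)
    have hsnd : #(R × (J →₀ ℤ)) ≤ #J := by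
      rw [Cardinal.mk_prod]
      exact Cardinal.mul_le_of_le hJ₀ ((by simp : lift.{u} #R ≤ ℵ₀).trans hJ₀) (by simp)
    refine (Cardinal.mk_subtype_le _).trans ?_
    rw [Cardinal.mk_prod, Cardinal.lift_id, Cardinal.lift_id]
    exact Cardinal.mul_le_of_le hJ₀ hfst hsnd
  · refine Cardinal.mk_le_of_injective (f := fun j => ⟨(0, 0, Finsupp.single j 1),
      mem_base.2 (Eventually.of_forall fun _ => rfl)⟩) fun j k hjk => ?_
    simpa [Finsupp.single_left_inj] using hjk

/-- The automorphism `(x, r, z) ↦ (x, r + x i, z)`. It conjugates `constPair l J e 0` to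
`constPair l J e e` over the parameters whose first component vanishes at `i`. -/
noncomputable def shear (i : I) : TestGroup l A J ≃+ TestGroup l A J :=
  (LinearEquiv.skewProd (.refl ℤ _) (.refl ℤ _) (((AddMonoidHom.inl R (J →₀ ℤ)).comp
    ((Pi.evalAddMonoidHom (fun _ => R) i).comp
      (eventuallyMem l A).subtype)).toIntLinearMap)).toAddEquiv

theorem shear_apply (i : I) (x : TestGroup l A J) : shear i x = (x.1, x.2.1 + x.1.1 i, x.2.2) := by
  simp [shear, Prod.ext_iff]

/-- The element with constant first component `e` and second component `r`. For `e ≠ 0` the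
elements `constPair l J e 0` and `constPair l J e e` have different types over `base l A J`. -/
noncomputable def constPair (l : Filter I) (J : Type u) (e : A) (r : R) : TestGroup l A J :=
  (⟨fun _ => e, Eventually.of_forall fun _ => e.2⟩, r, 0)

theorem exists_shear_eq_self [l.NeBot] {μ : Cardinal.{u}} [CardinalInterFilter l μ]
    {B : Set (base l A J)} (hB : #B < μ) : ∃ i, ∀ x ∈ B, shear i x.1 = x.1 := by
  have hvanish : ∀ᶠ i in l, ∀ x : B, x.1.1.1.1 i = 0 :=
    (Filter.eventually_cardinal_forall hB).2 fun x => mem_base.1 x.1.2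
  obtain ⟨i, hi⟩ := hvanish.exists
  refine ⟨i, fun x hx => ?_⟩
  rw [shear_apply, hi ⟨x, hx⟩, add_zero]

open GroupClass in
theorem not_E_constPair [CountableInterFilter l] [l.NeBot] (hl : l ≤ cofinite)
    (hI : ¬ IsUlamMeasurable I) (hR : IsSlender R) (hp₁ : p₁ ≠ 1) (hp₂ : p₂ ≠ 1)
    (hR₁ : pOmega p₁ R = ⊤) (hR₂ : pOmega p₂ R = ⊤) (hA₁ : pOmega p₁ A = ⊥)
    (hA₂ : pOmega p₂ A = ⊤) {κ : Cardinal.{u}} (hN : (K2 p₁ p₂ κ).Mem (TestGroup l A J))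
    {e : A} (he : e ≠ 0) :
    ¬ E (K := K2 p₁ p₂ κ)
      ⟨_, hN, .subtype (· ∈ base l A J), constPair l J e 0⟩
      ⟨_, hN, .subtype (· ∈ base l A J), constPair l J e e⟩ := by
  intro hE
  have hω₂ : ∀ x (r : R), ((x, r, 0) : TestGroup l A J) ∈ pOmega p₂ (TestGroup l A J) := by
    intro x r
    rw [pOmega_eq_prod hp₂ hR₂, pOmega_eventuallyMem_eq_top hR₂ hA₂]
    exact ⟨trivial, trivial, rfl⟩
  have hω₁ : constPair l J e 0 ∉ pOmega p₁ (TestGroup l A J) := by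
    rw [← base_inf_pOmega hp₁ hp₂ hR₁ hR₂ hA₁ hA₂]
    intro hmem
    exact he (Subtype.ext (mem_base.1 hmem.1).exists.choose_spec)
  obtain ⟨φ, hφb, hφ⟩ := E.hasPOmegaHom hE (hω₂ _ _) hω₁
  let ψ : eventuallyMem l A →+ R := AddMonoidHom.mk' (fun x => (φ ⟨(x, 0, 0), hω₂ x 0⟩).1.2.1) <| by
    intro x y
    have hadd : (⟨(x + y, 0, 0), hω₂ _ 0⟩ : pOmega p₂ (TestGroup l A J)) =
        ⟨(x, 0, 0), hω₂ x 0⟩ + ⟨(y, 0, 0), hω₂ y 0⟩ := by simp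
    simp only [hadd, map_add, AddSubgroup.coe_add, Prod.snd_add, Prod.fst_add]
  have hψ : ψ = 0 := hR.eq_zero_of_eventuallyMem hI hl ψ fun x hx =>
    congrArg (fun y : TestGroup l A J => y.2.1) (hφ ⟨(x, 0, 0), mem_base.2 hx⟩ ⟨_, hω₂ x 0⟩ rfl)
  have hψe : ψ (constPair l J e 0).1 = e :=
    congrArg (fun y : TestGroup l A J => y.2.1) (hφb ⟨constPair l J e 0, hω₂ _ 0⟩ rfl)
  exact he (Subtype.ext (by rw [← hψe, hψ]; rfl))

end TestGroup

open TestGroup GroupClass in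
theorem not_isTame_K2_of_filter {I : Type u} {R : Type} [AddCommGroup R] [IsAddTorsionFree R]
    [Countable R] {A : AddSubgroup R} [Nontrivial A] {p₁ p₂ : ℕ} (hR : IsSlender R)
    (hp₁ : p₁ ≠ 1) (hp₂ : p₂ ≠ 1)
    (hR₁ : pOmega p₁ R = ⊤) (hR₂ : pOmega p₂ R = ⊤) (hA₁ : pOmega p₁ A = ⊥)
    (hA₂ : pOmega p₂ A = ⊤) {μ κ θ : Cardinal.{u}} (hμ : ℵ₀ < μ) (hI : ¬ IsUlamMeasurable I)
    (l : Filter I) [l.NeBot] [CardinalInterFilter l μ] (hl : l ≤ cofinite)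
    (hκ : 2 ^ #I ≤ κ) (hθ : 2 ^ #I ≤ θ) : ¬ (K2 p₁ p₂ κ).IsTame μ θ := by
  intro htame
  obtain ⟨J, rfl⟩ : ∃ J : Type u, #J = θ := ⟨θ.out, θ.mk_out⟩
  have : CountableInterFilter l := CardinalInterFilter.toCountableInterFilter l hμ
  have : Infinite I := not_finite_iff_infinite.1 fun h =>
    (neBot_of_le hl).ne (cofinite_eq_bot_iff.2 h)
  obtain ⟨e, he⟩ := exists_ne (0 : A)
  have hN : K2Mem p₁ p₂ κ (TestGroup l A J) := K2Mem_testGroup hp₁ hp₂ hκ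
  have hbase : (K2 p₁ p₂ κ).Le (base l A J) := K2_le_of_inf_pOmega_eq hN isPureSubgroup_base
    (base_inf_pOmega hp₁ hp₂ hR₁ hR₂ hA₁ hA₂)
  refine not_E_constPair hl hI hR hp₁ hp₂ hR₁ hR₂ hA₁ hA₂ hN he ?_
  refine IsTame.E_of_conjugate K2_le_top (mk_base (A := A) (l := l) hθ ▸ htame) hbase.1 hN
    (isEmbedding_subtype hbase) fun B hB => ?_
  obtain ⟨i, hi⟩ := exists_shear_eq_self hB
  exact ⟨shear i, hi, by simp [shear_apply, constPair]⟩

theorem not_isUlamMeasurable_of_lt {I : Type u} (hI : ∀ κ, IsMeasurableCardinal κ → #I < κ) :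
    ¬ IsUlamMeasurable I := fun h =>
  let ⟨κ, hκ, hle⟩ := h.exists_isMeasurableCardinal_le
  (hI κ hκ).not_ge hle

theorem exists_isSlender_pOmega_eq {p₁ p₂ : ℕ} (hp₁ : ¬ p₁.primeFactors ⊆ p₂.primeFactors)
    (hp₂ : p₂ ≠ 0) : ∃ (R : Type) (_ : AddCommGroup R) (_ : IsAddTorsionFree R) (_ : Countable R)
      (A : AddSubgroup R) (_ : Nontrivial A), IsSlender R ∧ pOmega p₁ R = ⊤ ∧ pOmega p₂ R = ⊤ ∧
      pOmega p₁ A = ⊥ ∧ pOmega p₂ A = ⊤ := by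
  obtain ⟨q, hq₁, hq₂⟩ := Finset.not_subset.1 hp₁
  obtain ⟨hq, hqp₁, hp₁₀⟩ := Nat.mem_primeFactors.1 hq₁
  have hqp₂ : p₂.Coprime q :=
    (hq.coprime_iff_not_dvd.2 fun h => hq₂ (Nat.mem_primeFactors.2 ⟨hq, h, hp₂⟩)).symm
  -- A non-invertible `r` makes the group slender; being coprime to `r`, `p₁` and `p₂` are inverted.
  let r := p₁ * p₂ + 1
  have hr₁ : p₁.Coprime r := by simp [r]
  have hr₂ : p₂.Coprime r := by simp [r]
  have hr : r ≠ 1 := by simp [r, hp₁₀, hp₂]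
  have hle : ratCoprimeDen (q * r) ≤ ratCoprimeDen r := ratCoprimeDen_anti (dvd_mul_left r q)
  let e := AddSubgroup.addSubgroupOfEquivOfLe hle
  have : Nontrivial (ratCoprimeDen (q * r)) :=
    ⟨⟨1, one_mem_ratCoprimeDen⟩, 0, fun h => one_ne_zero (congrArg Subtype.val h)⟩
  refine ⟨ratCoprimeDen r, inferInstance, ?_, inferInstance,
    (ratCoprimeDen (q * r)).addSubgroupOf (ratCoprimeDen r), e.toEquiv.nontrivial,
    isSlender_ratCoprimeDen (p₁ * p₂).succ_ne_zero hr, pOmega_ratCoprimeDen_eq_top hp₁₀ hr₁,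
    pOmega_ratCoprimeDen_eq_top hp₂ hr₂, ?_, ?_⟩
  · infer_instance
  · exact pOmega_eq_bot_of_injective (f := e.toAddMonoidHom) e.injective
      (pOmega_ratCoprimeDen_eq_bot hq.ne_one hqp₁ (dvd_mul_right q r))
  · exact pOmega_eq_top_of_surjective (f := e.symm.toAddMonoidHom) e.symm.surjective
      (pOmega_ratCoprimeDen_eq_top hp₂ (hqp₂.mul_right hr₂))

theorem lemma4p13_general (p₁ p₂ : ℕ) (hp₁ : ¬ p₁.primeFactors ⊆ p₂.primeFactors) (hp₂ : 1 < p₂)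
    (μ : Cardinal.{u}) (hreg : μ.IsRegular) (hunc : ℵ₀ < μ)
    (hmeas : ∀ κ : Cardinal.{u}, IsMeasurableCardinal κ → μ < κ)
    (κ θ : Cardinal.{u}) (hκ : 2 ^ μ ≤ κ) (hθ : 2 ^ μ ≤ θ) : ¬ (K2 p₁ p₂ κ).IsTame μ θ := by
  obtain ⟨I, rfl⟩ : ∃ I : Type u, #I = μ := ⟨μ.out, μ.mk_out⟩
  have hI : ¬ IsUlamMeasurable I := not_isUlamMeasurable_of_lt hmeas
  obtain ⟨R, _, _, _, A, _, hR, hR₁, hR₂, hA₁, hA₂⟩ := exists_isSlender_pOmega_eq hp₁ (by omega)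
  have : (cocardinal I hreg).NeBot := by
    refine ⟨fun hbot => ?_⟩
    simpa [mem_cocardinal] using empty_mem_iff_bot.2 hbot
  have hl : cocardinal I hreg ≤ cofinite := fun s hs =>
    by simpa using (mem_cofinite.1 hs).compl_mem_cocardinal (hreg := hreg)
  exact not_isTame_K2_of_filter hR (by rintro rfl; simp at hp₁) hp₂.ne' hR₁ hR₂ hA₁ hA₂ hunc hI
    (cocardinal I hreg) hl hκ hθ

theorem lemma4p13 (p₁ p₂ : ℕ) (hp₁ : p₁.Prime) (hp₂ : p₂.Prime) (hp : p₁ ≠ p₂)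
    (μ : Cardinal.{u}) (hreg : μ.IsRegular) (hunc : ℵ₀ < μ)
    (hmeas : ∀ κ : Cardinal.{u}, IsMeasurableCardinal κ → μ < κ)
    (θ : Cardinal.{u}) (hθ : 2 ^ μ ≤ θ) :
    ¬ (K2 p₁ p₂ (2 ^ μ)).IsTame μ θ :=
  lemma4p13_general p₁ p₂ (by simpa [hp₁.primeFactors, hp₂.primeFactors] using hp) hp₂.one_lt μ
    hreg hunc hmeas _ θ le_rfl hθ
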